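/- **Lemma (reduction to block Krylov).** For $k\ge 0$ let $H_k=\{(i,j): i\ge 0,\ 1\le j\le k,\ i+j\le k+1\}$ (so $H_0=\emptyset$), and for a matrix $M\in\mathbb R^{d\times d}$ and vectors $x_1,\dots,x_K\in\mathbb R^d$ write $\{M^i x_j\}_{H_k}=\{M^i x_j\}_{(i,j)\in H_k}$. An *adaptive deterministic algorithm* making $K$ extended oracle queries is a collection of measurable functions $v_1,v_2(\cdot),\dots,v_K(\cdot)$, where $v_k$ maps a family of vectors of $\mathbb R^d$ indexed by $H_{k-1}$ to a vector of $\mathbb R^d$ ($v_1$ is a constant vector). Run on a matrix $\Lambda$, it makes the queries $v^{\mathrm{alg}}_1=v_1$ and $v^{\mathrm{alg}}_k=v_k(\{\Lambda^i v^{\mathrm{alg}}_j\}_{H_{k-1}})$, $k\ge2$. It makes *orthonormal queries* on $\Lambda$ if every $v^{\mathrm{alg}}_k$ is a unit vector orthogonal to all the vectors $\Lambda^i v^{\mathrm{alg}}_j$, $(i,j)\in H_{k-1}$. Let $K^2<d$ and let such an algorithm be given. Then there are measurable functions $\tilde v_k(\cdot)$ with values in the unit sphere of $\mathbb R^d$ and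 measurable functions $\tilde U_k(\cdot)$ with values in the orthogonal group $O(d)$, for $k=1,\dots,K$, each of a family of vectors indexed by $H_{k-1}$ and one more vector, and a measurable map $R$ from families of vectors indexed by $H_K$ to such families, all depending only on $d$, $K$ and the algorithm, such that the following holds. Let $\Lambda=U^\top D U$, where $U$ is a Haar-random orthogonal $d\times d$ matrix, $D$ is a random real diagonal matrix with an arbitrary law, and $U$ and $D$ are independent. Let $z_1,\dots,z_K$ be i.i.d. standard Gaussian vectors in $\mathbb R^d$, independent of $\Lambda$. Suppose that, almost surely, the algorithm makes orthonormal queries on $\Lambda$. Put $\tilde v_k=\tilde v_k(\{\Lambda^i z_j\}_{H_{k-1}},z_k)$, $\tilde U_k=\tilde U_k(\{\Lambda^i z_j\}_{H_{k-1}},z_k)$ and $\tilde U_{1:K}=\tilde U_1\cdots\tilde U_K$. Then $$\{(\tilde U_{1:K})^\top\Lambda^i\tilde v_j\}_{H_K}\ \overset{d}{=}\ \{\Lambda^i v^{\mathrm{alg}}_j\}_{H_K}$$ as random families of vectors, and almost surely $\{\Lambda^i\tilde v_j\}_{H_K}=R(\{\Lambda^i z_j\}_{H_K})$. -/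

import Mathlib

open MeasureTheory ProbabilityTheory

/-- Vectors of `ℝ^d` with the Euclidean norm. -/
abbrev Vec (d : ℕ) : Type := EuclideanSpace ℝ (Fin d)

/-- The entrywise (equivalently Borel) `σ`-algebra on real matrices. -/
instance Matrix.instMeasurableSpaceReal (d : ℕ) : MeasurableSpace (Matrix (Fin d) (Fin d) ℝ) :=
  inferInstanceAs (MeasurableSpace (Fin d → Fin d → ℝ))

instance Matrix.instBorelSpaceReal (d : ℕ) : BorelSpace (Matrix (Fin d) (Fin d) ℝ) :=
  inferInstanceAs (BorelSpace (Fin d → Fin d → ℝ))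

/-- The matrix-vector product `M x`, for `x` in Euclidean space. -/
noncomputable def act {d : ℕ} (M : Matrix (Fin d) (Fin d) ℝ) (x : Vec d) : Vec d :=
  Matrix.toEuclideanCLM (n := Fin d) (𝕜 := ℝ) M x

theorem act_eq {d : ℕ} (M : Matrix (Fin d) (Fin d) ℝ) (x : Vec d) :
    act M x = WithLp.toLp 2 (M.mulVec x.ofLp) := rfl

/-- The index set `H_k = {(i, j) : i ≥ 0, 1 ≤ j ≤ k, i + j ≤ k + 1}`. Queries are numbered from `0`
here, so that the pair `(i, j)` of the usual numbering is written `(i, j - 1)`: the conditions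
become `j < k` and `i + j ≤ k` (which forces `i ≤ k`). -/
abbrev H (k : ℕ) : Type := {p : Fin (k + 1) × Fin k // (p.1 : ℕ) + (p.2 : ℕ) ≤ k}

/-- The data `{M^i x_j}` for `(i, j) ∈ H_k`, where `k ≤ K` and `x_1, …, x_K` are vectors. -/
noncomputable def krylov {d K : ℕ} (M : Matrix (Fin d) (Fin d) ℝ) (x : Fin K → Vec d)
    (k : ℕ) (hk : k ≤ K) : H k → Vec d :=
  fun p => act (M ^ (p.1.1 : ℕ)) (x (Fin.castLE hk p.1.2))

/-- An adaptive deterministic algorithm making `K` extended oracle queries: the query number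
`k + 1` is a (measurable) function `next k` of the data indexed by `H_k`. As `H_0` is empty, the
first query is constant. -/
structure AdaptiveAlgorithm (d K : ℕ) where
  next : (k : Fin K) → (H k → Vec d) → Vec d
  measurable_next : ∀ k, Measurable (next k)

namespace AdaptiveAlgorithm

/-- The queries made by the algorithm when the unknown matrix is `M`; see `query_eq` for the
recursion in terms of `krylov`. -/
noncomputable def query {d K : ℕ} (A : AdaptiveAlgorithm d K) (M : Matrix (Fin d) (Fin d) ℝ)
    (k : Fin K) : Vec d :=
  A.next k (fun p => act (M ^ (p.1.1 : ℕ)) (A.query M ⟨p.1.2, p.1.2.isLt.trans k.isLt⟩))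
termination_by (k : ℕ)
decreasing_by exact p.1.2.isLt

theorem query_eq {d K : ℕ} (A : AdaptiveAlgorithm d K) (M : Matrix (Fin d) (Fin d) ℝ)
    (k : Fin K) : A.query M k = A.next k (krylov M (A.query M) k k.isLt.le) := by
  rw [query]
  rfl

/-- When run on `M`, the algorithm makes orthonormal queries: each query is a unit vector,
orthogonal to all the vectors known to the algorithm when it makes the query. -/
def OrthonormalOn {d K : ℕ} (A : AdaptiveAlgorithm d K) (M : Matrix (Fin d) (Fin d) ℝ) : Prop :=
  ∀ k : Fin K, ‖A.query M k‖ = 1 ∧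
    ∀ p : H k, inner ℝ (A.query M k) (krylov M (A.query M) k k.isLt.le p) = 0

end AdaptiveAlgorithm

/-- The matrix `Uᵀ D U`, where `D` is the diagonal matrix with diagonal entries `D 0, D 1, …`. -/
def rotatedDiag {d : ℕ} (U : Matrix.orthogonalGroup (Fin d) ℝ) (D : Fin d → ℝ) :
    Matrix (Fin d) (Fin d) ℝ :=
  (U : Matrix (Fin d) (Fin d) ℝ).transpose * Matrix.diagonal D * (U : Matrix (Fin d) (Fin d) ℝ)

/-- The vectors `y_k`, for `k = 1, …, K`, where `y_k = f_k ({M^i z_j}_{H_{k-1}}, z_k)`. It is used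
for the simulated unit vectors and for the simulated rotations. -/
noncomputable def fromKrylov {d K : ℕ} {α : Type} (f : (k : Fin K) → (H k → Vec d) → Vec d → α)
    (M : Matrix (Fin d) (Fin d) ℝ) (z : Fin K → Vec d) (k : Fin K) : α :=
  f k (krylov M z k k.isLt.le) (z k)

/-- The family `{Wᵀ x_{i, j}}` for `(i, j) ∈ H_K`, with `W = W_1 ⋯ W_K` (in this order). -/
noncomputable def rotateBack {d K : ℕ} (W : Fin K → Matrix.orthogonalGroup (Fin d) ℝ)
    (x : H K → Vec d) : H K → Vec d :=
  fun p => act ((List.ofFn W).prod : Matrix (Fin d) (Fin d) ℝ).transpose (x p)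

/-! ### Matrix-vector products -/

section Act

variable {d : ℕ}

/-! The law of `Λ = Uᵀ D U` is invariant under orthogonal conjugation, so whatever direction the
algorithm picks orthogonally to its data can be replaced by a random one, up to a rotation fixing
the data. The simulated vector `ṽ_k` is the normalized component of `z_k` orthogonal to the block
Krylov data `{Λ^i z_j}` of the earlier steps. As `K ^ 2 < d`, that data a.s. never spans the space,
and the component is nonzero.

Let `Q_0 = 1` and `Q_{k+1} = W_{k+1} Q_k`, where `W_{k+1}` is the reflection exchanging `ṽ_{k+1}`
with `Q_k` applied to the query number `k + 1` made on `L_k = Q_k⁻¹ Λ Q_k`. Both are unit vectors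
orthogonal to the known data, so the reflection fixes the data. Hence the earlier queries are
unchanged, and by induction the first `k` queries on `L_k` are `Q_k⁻¹ ṽ_j` (`query_rotatedMatrix`).
With `Ũ_k = Q_{k-1}⁻¹ W_k Q_{k-1}` the product `Ũ_1 ⋯ Ũ_K` telescopes to `Q_K`, so the rotated-back
family is exactly what the algorithm sees on `L_K` (`rotateBack_eq_krylov_query`).

It remains that `L_K` has the law of `Λ` (`map_rotatedMatrix`). Passing from `L_k` to `L_{k+1}`
amounts to conjugating by a rotation that depends on the data and on an independent Gaussian, and
that fixes the data. Averaging over the stabilizer of the data shows that such a substitution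
preserves the joint law (`map_stabilizer_eq`). Equality of laws also transfers the almost sure
orthonormality of the queries from `Λ` to every `L_k`, as the induction requires.

The map `R` is explicit (`simData`): `Λ^i ṽ_j` is a combination of vectors `Λ^{i+i'} z_{j'}` with
coefficients read off from the data. -/

theorem act_act (M N : Matrix (Fin d) (Fin d) ℝ) (x : Vec d) : act M (act N x) = act (M * N) x := by
  simp [act_eq]

@[simp] theorem act_one (x : Vec d) : act 1 x = x := by
  simp [act_eq]

theorem act_add (M : Matrix (Fin d) (Fin d) ℝ) (x y : Vec d) : act M (x + y) = act M x + act M y :=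
  map_add _ _ _

theorem act_sub (M : Matrix (Fin d) (Fin d) ℝ) (x y : Vec d) : act M (x - y) = act M x - act M y :=
  map_sub _ _ _

theorem act_smul (M : Matrix (Fin d) (Fin d) ℝ) (c : ℝ) (x : Vec d) :
    act M (c • x) = c • act M x :=
  map_smul _ _ _

theorem act_sum {ι : Type*} (M : Matrix (Fin d) (Fin d) ℝ) (s : Finset ι) (f : ι → Vec d) :
    act M (∑ i ∈ s, f i) = ∑ i ∈ s, act M (f i) :=
  map_sum _ _ _

theorem inner_act_left (M : Matrix (Fin d) (Fin d) ℝ) (x y : Vec d) :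
    inner ℝ (act M x) y = inner ℝ x (act M.transpose y) := by
  simp only [act_eq, EuclideanSpace.inner_eq_star_dotProduct, star_trivial]
  rw [Matrix.dotProduct_mulVec, Matrix.mulVec_transpose]

theorem continuous_act : Continuous fun p : Matrix (Fin d) (Fin d) ℝ × Vec d => act p.1 p.2 := by
  simp only [act_eq]
  refine (PiLp.continuous_toLp 2 _).comp ?_
  exact continuous_fst.matrix_mulVec ((PiLp.continuous_ofLp 2 _).comp continuous_snd)

instance : SecondCountableTopology (Matrix (Fin d) (Fin d) ℝ) :=
  inferInstanceAs (SecondCountableTopology (Fin d → Fin d → ℝ))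

theorem Measurable.matVec {α : Type*} [MeasurableSpace α] {M : α → Matrix (Fin d) (Fin d) ℝ}
    {x : α → Vec d} (hM : Measurable M) (hx : Measurable x) :
    Measurable fun a => act (M a) (x a) :=
  Measurable.comp (g := fun p : Matrix (Fin d) (Fin d) ℝ × Vec d => act p.1 p.2)
    (f := fun a => (M a, x a)) continuous_act.measurable (hM.prodMk hx)

end Act

/-! ### The orthogonal group, conjugation and Householder reflections -/

section Orthogonal

variable {d : ℕ}

local notation "O(" d ")" => Matrix.orthogonalGroup (Fin d) ℝ

theorem coe_inv_eq_transpose (g : O(d)) :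
    ((g⁻¹ : O(d)) : Matrix (Fin d) (Fin d) ℝ) = (g : Matrix (Fin d) (Fin d) ℝ).transpose := rfl

theorem coe_mul_orth (g h : O(d)) :
    ((g * h : O(d)) : Matrix (Fin d) (Fin d) ℝ) = (g : Matrix (Fin d) (Fin d) ℝ) * h := rfl

theorem coe_inv_mul_coe (g : O(d)) :
    ((g⁻¹ : O(d)) : Matrix (Fin d) (Fin d) ℝ) * (g : Matrix (Fin d) (Fin d) ℝ) = 1 := by
  rw [← coe_mul_orth, inv_mul_cancel]; rfl

theorem coe_mul_coe_inv (g : O(d)) :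
    (g : Matrix (Fin d) (Fin d) ℝ) * ((g⁻¹ : O(d)) : Matrix (Fin d) (Fin d) ℝ) = 1 := by
  rw [← coe_mul_orth, mul_inv_cancel]; rfl

instance : CompactSpace O(d) := by
  have : IsCompact {A : Matrix (Fin d) (Fin d) ℝ | A ∈ Matrix.orthogonalGroup (Fin d) ℝ} := by
    have hc : IsCompact (Set.pi Set.univ fun _ : Fin d => Set.pi Set.univ fun _ : Fin d =>
        Metric.closedBall (0 : ℝ) 1) :=
      isCompact_univ_pi fun _ => isCompact_univ_pi fun _ => isCompact_closedBall _ _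
    refine hc.of_isClosed_subset ?_ ?_
    · exact isClosed_unitary (R := Matrix (Fin d) (Fin d) ℝ)
    · intro A hA i _ j _
      simpa using entry_norm_bound_of_unitary hA i j
  exact isCompact_iff_compactSpace.mp this

instance : IsTopologicalGroup O(d) :=
  inferInstanceAs (IsTopologicalGroup (unitary (Matrix (Fin d) (Fin d) ℝ)))
instance : BorelSpace O(d) := Subtype.borelSpace _
instance : SecondCountableTopology O(d) := 
  TopologicalSpace.Subtype.secondCountableTopology _

/-- Conjugation of a matrix by an orthogonal matrix. -/
def rotM (g : O(d)) (M : Matrix (Fin d) (Fin d) ℝ) : Matrix (Fin d) (Fin d) ℝ :=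
  (g : Matrix (Fin d) (Fin d) ℝ) * M * ((g⁻¹ : O(d)) : Matrix (Fin d) (Fin d) ℝ)

@[simp] theorem rotM_one (M : Matrix (Fin d) (Fin d) ℝ) : rotM 1 M = M := by
  simp [rotM]

theorem rotM_mul (g h : O(d)) (M : Matrix (Fin d) (Fin d) ℝ) :
    rotM (g * h) M = rotM g (rotM h M) := by
  simp only [rotM, mul_inv_rev, coe_mul_orth, mul_assoc]

theorem rotM_pow (g : O(d)) (M : Matrix (Fin d) (Fin d) ℝ) (i : ℕ) :
    rotM g M ^ i = rotM g (M ^ i) := by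
  induction i with
  | zero => rw [pow_zero, pow_zero, rotM, mul_one, coe_mul_coe_inv]
  | succ n ih =>
    rw [pow_succ, ih, pow_succ]
    simp only [rotM, mul_assoc]
    rw [← mul_assoc _ (g : Matrix (Fin d) (Fin d) ℝ), coe_inv_mul_coe, one_mul]

theorem act_rotM_pow (g : O(d)) (M : Matrix (Fin d) (Fin d) ℝ) (i : ℕ) (x : Vec d) :
    act (rotM g M ^ i) (act g x) = act g (act (M ^ i) x) := by
  rw [rotM_pow, rotM, act_act, act_act, mul_assoc, coe_inv_mul_coe, mul_one]

theorem act_inv_act (g : O(d)) (x : Vec d) :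
    act ((g⁻¹ : O(d)) : Matrix (Fin d) (Fin d) ℝ) (act g x) = x := by
  rw [act_act, coe_inv_mul_coe, act_one]

theorem act_act_inv (g : O(d)) (x : Vec d) :
    act g (act ((g⁻¹ : O(d)) : Matrix (Fin d) (Fin d) ℝ) x) = x := by
  rw [act_act, coe_mul_coe_inv, act_one]

theorem inner_act_act (g : O(d)) (x y : Vec d) : inner ℝ (act g x) (act g y) = inner ℝ x y := by
  rw [inner_act_left, ← coe_inv_eq_transpose, act_inv_act]

theorem norm_act (g : O(d)) (x : Vec d) : ‖act g x‖ = ‖x‖ := by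
  rw [norm_eq_sqrt_real_inner, inner_act_act, ← norm_eq_sqrt_real_inner]

/-- The linear isometry given by an orthogonal matrix. -/
noncomputable def actIsometry (g : O(d)) : Vec d ≃ₗᵢ[ℝ] Vec d where
  toFun := act g
  invFun := act ((g⁻¹ : O(d)) : Matrix (Fin d) (Fin d) ℝ)
  map_add' := act_add _
  map_smul' := act_smul _
  left_inv := act_inv_act g
  right_inv := act_act_inv g
  norm_map' := norm_act g

theorem continuous_rotM :
    Continuous fun p : O(d) × Matrix (Fin d) (Fin d) ℝ => rotM p.1 p.2 := by
  unfold rotM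
  exact ((continuous_subtype_val.comp continuous_fst).matrix_mul continuous_snd).matrix_mul
    (continuous_subtype_val.comp continuous_fst.inv)

theorem Measurable.matConj {α : Type*} [MeasurableSpace α] {g : α → O(d)}
    {M : α → Matrix (Fin d) (Fin d) ℝ} (hg : Measurable g) (hM : Measurable M) :
    Measurable fun a => rotM (g a) (M a) :=
  Measurable.comp (g := fun p : O(d) × Matrix (Fin d) (Fin d) ℝ => rotM p.1 p.2)
    (f := fun a => (g a, M a)) continuous_rotM.measurable (hg.prodMk hM)

/-- The reflection `x ↦ x - 2 ⟪w, x⟫ / ⟪w, w⟫ • w`; it is the identity if `w = 0`. -/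
noncomputable def householder (w : Vec d) : O(d) :=
  ⟨1 - (2 / inner ℝ w w) • Matrix.vecMulVec w.ofLp w.ofLp, by
    have hw : w.ofLp ⬝ᵥ w.ofLp = inner ℝ w w := by
      rw [EuclideanSpace.inner_eq_star_dotProduct, star_trivial]
    rw [Matrix.mem_orthogonalGroup_iff]
    have h1 : (1 - (2 / inner ℝ w w) • Matrix.vecMulVec w.ofLp w.ofLp).transpose =
        1 - (2 / inner ℝ w w) • Matrix.vecMulVec w.ofLp w.ofLp := by
      ext i j
      simp [Matrix.transpose_apply, Matrix.one_apply, Matrix.vecMulVec_apply, mul_comm,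
        eq_comm]
    rw [h1, mul_sub, sub_mul, sub_mul, mul_one, one_mul, mul_one, smul_mul_smul_comm,
      Matrix.vecMulVec_mul_vecMulVec, hw]
    rcases eq_or_ne (inner ℝ w w) 0 with h0 | h0
    · rw [h0, div_zero, zero_smul, mul_zero, zero_smul, sub_zero, sub_zero, sub_zero]
    · ext i j
      simp only [Matrix.vecMulVec_apply, Matrix.sub_apply, Matrix.smul_apply, smul_eq_mul,
        Pi.smul_apply]
      field_simp
      ring⟩

theorem act_householder (w x : Vec d) :
    act (householder w) x = x - (2 / inner ℝ w w * inner ℝ w x) • w := by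
  have hx : w.ofLp ⬝ᵥ x.ofLp = inner ℝ w x := by
    simp [EuclideanSpace.inner_eq_star_dotProduct, dotProduct_comm]
  ext i
  simp [householder, act_eq, Matrix.sub_mulVec, Matrix.smul_mulVec, Matrix.vecMulVec_mulVec, hx]
  ring

theorem act_householder_of_inner_eq_zero {w x : Vec d} (h : inner ℝ w x = 0) :
    act (householder w) x = x := by
  simp [act_householder, h]

/-- Equal norms make `u - v` orthogonal to `u + v`, so the reflection in the hyperplane normal to `u
- v` exchanges `u` and `v`. -/
theorem act_householder_sub {u v : Vec d} (h : ‖u‖ = ‖v‖) : act (householder (u - v)) u = v := by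
  rw [act_householder]
  rcases eq_or_ne u v with rfl | huv
  · simp
  have h1 : inner ℝ (u - v) (u - v) ≠ 0 := by
    rw [real_inner_self_eq_norm_sq]
    exact pow_ne_zero _ (norm_ne_zero_iff.mpr (sub_ne_zero.mpr huv))
  have h2 : inner ℝ (u - v) (u - v) = 2 * inner ℝ (u - v) u := by
    simp only [inner_sub_left, inner_sub_right, real_inner_self_eq_norm_sq, h, real_inner_comm u v]
    ring
  have h3 : 2 / inner ℝ (u - v) (u - v) * inner ℝ (u - v) u = 1 := by
    rw [div_mul_eq_mul_div, ← h2, div_self h1]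
  rw [h3, one_smul, sub_sub_cancel]

theorem measurable_householder : Measurable (householder (d := d)) := by
  refine Measurable.subtype_mk ?_
  refine measurable_pi_lambda _ fun i => measurable_pi_lambda _ fun j => ?_
  simp only [Matrix.sub_apply, Matrix.smul_apply, Matrix.vecMulVec_apply]
  fun_prop

end Orthogonal

/-! ### Invariant measures on compact groups and averaging over stabilizers -/

section CompactGroup

variable {G : Type*} [Group G] [TopologicalSpace G] [IsTopologicalGroup G]
  [MeasurableSpace G] [BorelSpace G]

/-- A left-invariant probability measure on a compact group is right-invariant. -/
theorem isMulRightInvariant_of_probability [SecondCountableTopology G]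
    {ν : Measure G} [IsProbabilityMeasure ν]
    [ν.IsMulLeftInvariant] : ν.IsMulRightInvariant := by
  have hinv : ν.inv = ν := by
    have : IsProbabilityMeasure ν.inv := Measure.isProbabilityMeasure_map measurable_inv.aemeasurable
    refine Measure.ext_of_lintegral _ fun f hf => ?_
    -- Integrating `f (x * y)` against `ν.inv ⊗ ν` in the two orders uses right invariance of
    -- `ν.inv` or left invariance of `ν`, and so identifies the two measures.
    have h1 : ∫⁻ y, ∫⁻ x, f (x * y) ∂ν.inv ∂ν = ∫⁻ x, f x ∂ν.inv := by
      simp [lintegral_mul_right_eq_self (μ := ν.inv) f]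
    have h2 : ∫⁻ x, ∫⁻ y, f (x * y) ∂ν ∂ν.inv = ∫⁻ x, f x ∂ν := by
      simp [lintegral_mul_left_eq_self (μ := ν) f]
    rw [← h1, ← h2]
    exact lintegral_lintegral_swap
      (hf.comp (measurable_snd.mul measurable_fst)).aemeasurable
  rw [← hinv]
  infer_instance

theorem exists_isProbabilityMeasure_isMulLeftInvariant [CompactSpace G] :
    ∃ ν : Measure G, IsProbabilityMeasure ν ∧ ν.IsMulLeftInvariant := by
  let K : TopologicalSpace.PositiveCompacts G := ⊤
  refine ⟨Measure.haarMeasure K, ⟨?_⟩, inferInstance⟩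
  exact Measure.haarMeasure_self (K₀ := K)

variable [CompactSpace G] [SecondCountableTopology G]
variable {X Y : Type*} [MeasurableSpace X] [TopologicalSpace Y] [T1Space Y]

/-- Let `P` be invariant under the action `a` of a compact group `G`, and let `π` be equivariant.
If `W x` is in the stabilizer of `π x` and `W` is invariant under this stabilizer, then
`x ↦ a (W x) x` preserves `P`. -/
theorem map_stabilizer_eq {a : G → X → X} {b : G → Y → Y} {π : X → Y} {W : X → G}
    {P : Measure X} [IsProbabilityMeasure P]
    (ham : Measurable fun p : G × X => a p.1 p.2) (ha : ∀ g h x, a (g * h) x = a g (a h x))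
    (hbc : ∀ y, Continuous fun g => b g y) (hb1 : ∀ y, b 1 y = y)
    (hb : ∀ g h y, b (g * h) y = b g (b h y)) (hπ : ∀ g x, π (a g x) = b g (π x))
    (hP : ∀ g, P.map (a g) = P) (hWm : Measurable W) (hW : ∀ x, b (W x) (π x) = π x)
    (hWs : ∀ x s, b s (π x) = π x → W (a s x) = W x) :
    P.map (fun x => a (W x) x) = P := by
  obtain ⟨ν, hν, hνl⟩ := exists_isProbabilityMeasure_isMulLeftInvariant (G := G)
  have hνr : ν.IsMulRightInvariant := isMulRightInvariant_of_probability
  have ham' (g : G) : Measurable (a g) := ham.comp measurable_prodMk_left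
  have hTm : Measurable fun x => a (W x) x := ham.comp (hWm.prodMk measurable_id)
  refine Measure.ext_of_lintegral _ fun f hf => ?_
  rw [lintegral_map hf hTm]
  have hrot {φ : X → ENNReal} (hφ : Measurable φ) :
      ∫⁻ x, φ x ∂P = ∫⁻ x, ∫⁻ g, φ (a g x) ∂ν ∂P := by
    rw [lintegral_lintegral_swap (f := fun x g => φ (a g x))
      (hφ.comp (ham.comp measurable_swap)).aemeasurable]
    have (g : G) : ∫⁻ x, φ (a g x) ∂P = ∫⁻ x, φ x ∂P := by
      rw [← lintegral_map hφ (ham' g), hP]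
    simp [this]
  rw [hrot (φ := fun x => f (a (W x) x)) (hf.comp hTm), hrot hf]
  refine lintegral_congr fun x => ?_
  -- After averaging over `G`, the claim is an identity along the orbit of a fixed `x`; each `g` is
  -- averaged further over the coset `g * S`.
  let S : Subgroup G :=
    { carrier := {s | b s (π x) = π x}
      mul_mem' := fun {s t} hs ht => by
        simp only [Set.mem_ofPred_eq] at hs ht ⊢
        rw [hb, ht, hs]
      one_mem' := hb1 _
      inv_mem' := fun {s} hs => by
        simp only [Set.mem_ofPred_eq] at hs ⊢
        conv_lhs => rw [← hs]
        rw [← hb, inv_mul_cancel, hb1] }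
  have hS : IsClosed (S : Set G) := isClosed_singleton.preimage (hbc (π x))
  have : CompactSpace S := isCompact_iff_compactSpace.mp hS.isCompact
  obtain ⟨σ, hσ, hσl⟩ := exists_isProbabilityMeasure_isMulLeftInvariant (G := S)
  have hmean {φ : G → ENNReal} (hφ : Measurable φ) :
      ∫⁻ g, φ g ∂ν = ∫⁻ g, ∫⁻ s : S, φ (g * s) ∂σ ∂ν := by
    rw [lintegral_lintegral_swap (f := fun g (s : S) => φ (g * s)) (hφ.comp
      (measurable_fst.mul (measurable_subtype_coe.comp measurable_snd))).aemeasurable]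
    simp [lintegral_mul_right_eq_self (μ := ν) φ]
  have hax : Measurable fun g => a g x := ham.comp measurable_prodMk_right
  rw [hmean (φ := fun g => f (a (W (a g x)) (a g x))) (hf.comp (hTm.comp hax)),
    hmean (φ := fun g => f (a g x)) (hf.comp hax)]
  refine lintegral_congr fun g => ?_
  -- `W` is constant along `g * S`. Conjugated by `g`, it is a left translation of `S`, which `σ`
  -- absorbs.
  have hc : g⁻¹ * W (a g x) * g ∈ S := by
    change b _ _ = _
    rw [hb, hb, ← hπ, hW, hπ, ← hb, inv_mul_cancel, hb1]
  rw [← lintegral_mul_left_eq_self (μ := σ) (fun s : S => f (a (g * s) x)) ⟨_, hc⟩]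
  refine lintegral_congr fun s => ?_
  have hWg : W (a (g * s) x) = W (a g x) := by
    have h1 : g * s = (g * s * g⁻¹) * g := by group
    rw [h1, ha]
    refine hWs _ _ ?_
    have hs : b s (π x) = π x := s.2
    rw [hπ, ← hb, ← h1, hb, hs]
  rw [hWg, ← ha]
  congr 2
  simp only [Subgroup.coe_mul]
  group

end CompactGroup

/-! ### Measurable orthogonal projection -/

section Projection

variable {E : Type*} [NormedAddCommGroup E] [InnerProductSpace ℝ E] [MeasurableSpace E]
  [BorelSpace E] [SecondCountableTopology E]

/-- Gram–Schmidt by induction on the number of vectors, with coefficients relative to the original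
family. Every formula is explicit, hence measurable, even where the family is dependent. -/
theorem exists_measurable_projCoeff_fin (n : ℕ) :
    ∃ c : (Fin n → E) → E → Fin n → ℝ, Measurable (Function.uncurry c) ∧
      ∀ y z j, inner ℝ (z - ∑ i, c y z i • y i) (y j) = 0 := by
  induction n with
  | zero => exact ⟨fun _ _ _ => 0, measurable_const, fun y z j => j.elim0⟩
  | succ n ih =>
    obtain ⟨c, hc, hcp⟩ := ih
    let e : (Fin n → E) → E → E := fun y z => z - ∑ i, c y z i • y i
    have he : Measurable (Function.uncurry e) := by
      refine measurable_snd.sub (Finset.measurable_sum _ fun i _ => Measurable.fun_smul ?_ ?_)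
      · exact (measurable_pi_apply i).comp hc
      · exact (measurable_pi_apply i).comp measurable_fst
    -- If the last vector is already in the span of the others, its residual is zero and the
    -- division by zero gives the coefficient `0`.
    let t : (Fin (n + 1) → E) → E → ℝ := fun y z =>
      inner ℝ (e (Fin.init y) z) (e (Fin.init y) (y (Fin.last n))) /
        inner ℝ (e (Fin.init y) (y (Fin.last n))) (e (Fin.init y) (y (Fin.last n)))
    have hinit : Measurable fun p : (Fin (n + 1) → E) × E => (Fin.init p.1 : Fin n → E) :=
      measurable_pi_lambda _ fun i => (measurable_pi_apply i.castSucc).comp measurable_fst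
    have hlast : Measurable fun p : (Fin (n + 1) → E) × E => p.1 (Fin.last n) :=
      (measurable_pi_apply _).comp measurable_fst
    have he1 : Measurable fun p : (Fin (n + 1) → E) × E => e (Fin.init p.1) p.2 :=
      he.comp (hinit.prodMk measurable_snd)
    have he2 : Measurable fun p : (Fin (n + 1) → E) × E => e (Fin.init p.1) (p.1 (Fin.last n)) :=
      he.comp (hinit.prodMk hlast)
    have ht : Measurable (Function.uncurry t) := (he1.inner he2).div (he2.inner he2)
    refine ⟨fun y z => Fin.snoc (α := fun _ => ℝ) (fun i => c (Fin.init y) z i -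
      t y z * c (Fin.init y) (y (Fin.last n)) i) (t y z), ?_, ?_⟩
    · refine measurable_pi_lambda _ fun i => ?_
      refine Fin.lastCases ?_ (fun i => ?_) i
      · simpa [Function.uncurry_def] using ht
      · have h1 : Measurable fun p : (Fin (n + 1) → E) × E => c (Fin.init p.1) p.2 i :=
          (measurable_pi_apply i).comp (hc.comp (hinit.prodMk measurable_snd))
        have h2 : Measurable fun p : (Fin (n + 1) → E) × E =>
            c (Fin.init p.1) (p.1 (Fin.last n)) i :=
          (measurable_pi_apply i).comp (hc.comp (hinit.prodMk hlast))
        simpa [Function.uncurry_def] using h1.fun_sub (ht.fun_mul h2)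
    · intro y z j
      have hsum : z - ∑ i, Fin.snoc (α := fun _ => ℝ) (fun i => c (Fin.init y) z i -
          t y z * c (Fin.init y) (y (Fin.last n)) i) (t y z) i • y i =
          e (Fin.init y) z - t y z • e (Fin.init y) (y (Fin.last n)) := by
        rw [Fin.sum_univ_castSucc]
        simp only [Fin.snoc_castSucc, Fin.snoc_last, e, sub_smul, Finset.sum_sub_distrib, smul_sub,
          Finset.smul_sum, smul_smul, Fin.init]
        abel
      rw [hsum]
      have horth : ∀ j, inner ℝ (e (Fin.init y) z - t y z • e (Fin.init y) (y (Fin.last n)))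
          (Fin.init y j) = 0 := fun j => by
        rw [inner_sub_left, inner_smul_left, hcp, hcp, mul_zero, sub_zero]
      refine Fin.lastCases ?_ horth j
      have hy : y (Fin.last n) = e (Fin.init y) (y (Fin.last n)) +
          ∑ i, c (Fin.init y) (y (Fin.last n)) i • Fin.init y i := by simp [e]
      nth_rewrite 2 [hy]
      rw [inner_add_right, inner_sum]
      simp only [inner_smul_right, horth, mul_zero, Finset.sum_const_zero, add_zero]
      rw [inner_sub_left, inner_smul_left, RCLike.conj_to_real]
      rcases eq_or_ne (e (Fin.init y) (y (Fin.last n))) 0 with h0 | h0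
      · simp [h0]
      · rw [div_mul_cancel₀ _ (by simpa using h0), sub_self]

/-- The coefficients of the orthogonal projection of `z` on the span of a finite family `y` can be
chosen measurably. -/
theorem exists_measurable_projCoeff (ι : Type*) [Fintype ι] :
    ∃ c : (ι → E) → E → ι → ℝ, Measurable (Function.uncurry c) ∧
      ∀ y z j, inner ℝ (z - ∑ i, c y z i • y i) (y j) = 0 := by
  obtain ⟨c, hc, hcp⟩ := exists_measurable_projCoeff_fin (E := E) (Fintype.card ι)
  let e := Fintype.equivFin ι
  refine ⟨fun y z i => c (fun k => y (e.symm k)) z (e i), ?_, fun y z j => ?_⟩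
  · have h1 : Measurable fun p : (ι → E) × E => ((fun k => p.1 (e.symm k)), p.2) :=
      Measurable.prodMk (measurable_pi_lambda _ fun k =>
        (measurable_pi_apply _).comp measurable_fst) measurable_snd
    exact measurable_pi_lambda _ fun i => (measurable_pi_apply (e i)).comp (hc.comp h1)
  · have h := hcp (fun k => y (e.symm k)) z (e j)
    rw [← e.sum_comp] at h
    simpa using h

end Projection

/-! ### The simulated vectors and rotations as functions of the data -/

section Simulation

variable {d K : ℕ}

local notation "O(" d ")" => Matrix.orthogonalGroup (Fin d) ℝ

/-- The element `(i, j)` of `H k`. -/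
def idx {k : ℕ} (i j : ℕ) (h : i + j ≤ k) (hj : j < k) : H k :=
  ⟨(⟨i, by omega⟩, ⟨j, hj⟩), h⟩

/-- Restriction of a family indexed by `H k` to the indices in `H j`, where `j ≤ k`. -/
def restr {k j : ℕ} (h : j ≤ k) (y : H k → Vec d) : H j → Vec d :=
  fun q => y (idx q.1.1 q.1.2 (q.2.trans h) (q.1.2.isLt.trans_le h))

theorem measurable_restr {k j : ℕ} (h : j ≤ k) : Measurable (restr (d := d) h) :=
  measurable_pi_lambda _ fun _ => measurable_pi_apply _

theorem restr_krylov (M : Matrix (Fin d) (Fin d) ℝ) (x : Fin K → Vec d) {k j : ℕ} (h : j ≤ k)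
    (hk : k ≤ K) : restr h (krylov M x k hk) = krylov M x j (h.trans hk) := rfl

theorem krylov_idx (M : Matrix (Fin d) (Fin d) ℝ) (x : Fin K → Vec d) {k : ℕ} (hk : k ≤ K)
    (i j : ℕ) (h : i + j ≤ k) (hj : j < k) :
    krylov M x k hk (idx i j h hj) = act (M ^ i) (x ⟨j, hj.trans_le hk⟩) := rfl

/-- Coefficients of the orthogonal projection on the span of a family indexed by `H k`. -/
noncomputable def projCoeff (k : ℕ) : (H k → Vec d) → Vec d → H k → ℝ :=
  (exists_measurable_projCoeff (E := Vec d) (H k)).choose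

theorem measurable_projCoeff (k : ℕ) : Measurable (Function.uncurry (projCoeff (d := d) k)) :=
  (exists_measurable_projCoeff (E := Vec d) (H k)).choose_spec.1

/-- The component of `z` orthogonal to the span of the family `y`. -/
noncomputable def resid (k : ℕ) (y : H k → Vec d) (z : Vec d) : Vec d :=
  z - ∑ q, projCoeff k y z q • y q

theorem inner_resid (k : ℕ) (y : H k → Vec d) (z : Vec d) (p : H k) :
    inner ℝ (resid k y z) (y p) = 0 :=
  (exists_measurable_projCoeff (E := Vec d) (H k)).choose_spec.2 y z p

theorem measurable_resid (k : ℕ) : Measurable (Function.uncurry (resid (d := d) k)) := by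
  refine measurable_snd.sub (Finset.measurable_sum _ fun i _ => Measurable.fun_smul ?_ ?_)
  · exact (measurable_pi_apply i).comp (measurable_projCoeff k)
  · exact (measurable_pi_apply i).comp measurable_fst

/-- The simulated unit vector: `resid k y z` normalized, or a default value `e` if it is zero. -/
noncomputable def simVec (e : Vec d) (k : ℕ) (y : H k → Vec d) (z : Vec d) : Vec d :=
  open Classical in if resid k y z = 0 then e else ‖resid k y z‖⁻¹ • resid k y z

theorem norm_simVec {e : Vec d} (he : ‖e‖ = 1) (k : ℕ) (y : H k → Vec d) (z : Vec d) :
    ‖simVec e k y z‖ = 1 := by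
  unfold simVec
  split_ifs with h
  · exact he
  · rw [norm_smul, norm_inv, norm_norm, inv_mul_cancel₀ (norm_ne_zero_iff.mpr h)]

theorem measurable_simVec (e : Vec d) (k : ℕ) :
    Measurable (Function.uncurry (simVec e k)) := by
  classical
  refine Measurable.ite (measurable_resid k (measurableSet_singleton 0)) measurable_const ?_
  exact (measurable_resid k).norm.inv.fun_smul (measurable_resid k)

/-- The data `{M^i v_j}` of the simulated vectors `v_j` as a function of the data `{M^i z_j}`. -/
noncomputable def simData (k : ℕ) (y : H k → Vec d) : H k → Vec d := fun p =>
  -- A zero residual yields zero coefficients here, whereas `simVec` then returns `e`; the two are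
  -- matched only for nondegenerate data.
  ‖resid p.1.2 (restr p.1.2.isLt.le y) (y (idx 0 p.1.2 (by omega) p.1.2.isLt))‖⁻¹ •
    (y p - ∑ q : H (p.1.2 : ℕ), projCoeff p.1.2 (restr p.1.2.isLt.le y)
        (y (idx 0 p.1.2 (by omega) p.1.2.isLt)) q •
      -- Applying `M^i` adds exponents: `i' + j' ≤ j` and `i + j ≤ k` keep the index in `H k`.
      y (idx (p.1.1 + q.1.1) q.1.2
        (by have := p.2; have := q.2; omega) (q.1.2.isLt.trans p.1.2.isLt)))

theorem measurable_simData (k : ℕ) : Measurable (simData (d := d) k) := by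
  refine measurable_pi_lambda _ fun p => ?_
  have h0 : Measurable fun y : H k → Vec d =>
      (restr p.1.2.isLt.le y, y (idx 0 p.1.2 (by omega) p.1.2.isLt)) :=
    (measurable_restr _).prodMk (measurable_pi_apply _)
  refine ((measurable_resid _).comp h0).norm.inv.fun_smul
    ((measurable_pi_apply _).sub (Finset.measurable_sum _ fun q _ => Measurable.fun_smul ?_ ?_))
  · exact (measurable_pi_apply q).comp ((measurable_projCoeff _).comp h0)
  · exact measurable_pi_apply _

/-- The orthogonal matrix by which the product of the simulated rotations is multiplied in step
`k`, in terms of the previous product `Q`. -/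
noncomputable def stepRot (A : AdaptiveAlgorithm d K) (e : Vec d) (k : Fin K) (Q : O(d))
    (y : H k → Vec d) (z : Vec d) : O(d) :=
  let w : Vec d := act Q (A.next k fun p =>
    act ((Q⁻¹ : O(d)) : Matrix (Fin d) (Fin d) ℝ) (simData k y p)) - simVec e k y z
  -- The test makes the rotation fix the data for every input, and not only almost surely, as the
  -- stabilizer argument demands.
  open Classical in if ∀ p, inner ℝ w (y p) = 0 then householder w else 1

theorem measurable_stepRot (A : AdaptiveAlgorithm d K) (e : Vec d) (k : Fin K) :
    Measurable fun p : O(d) × (H k → Vec d) × Vec d => stepRot A e k p.1 p.2.1 p.2.2 := by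
  classical
  have hQ : Measurable fun p : O(d) × (H k → Vec d) × Vec d =>
      (p.1 : Matrix (Fin d) (Fin d) ℝ) := measurable_subtype_coe.comp measurable_fst
  have hQi : Measurable fun p : O(d) × (H k → Vec d) × Vec d =>
      ((p.1⁻¹ : O(d)) : Matrix (Fin d) (Fin d) ℝ) :=
    measurable_subtype_coe.comp measurable_fst.inv
  have hy : Measurable fun p : O(d) × (H k → Vec d) × Vec d => p.2.1 :=
    measurable_fst.comp measurable_snd
  have hw : Measurable fun p : O(d) × (H k → Vec d) × Vec d =>
      act p.1 (A.next k fun q => act ((p.1⁻¹ : O(d)) : Matrix (Fin d) (Fin d) ℝ)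
        (simData k p.2.1 q)) - simVec e k p.2.1 p.2.2 := by
    refine Measurable.sub (Measurable.matVec hQ ((A.measurable_next k).comp ?_)) ?_
    · exact measurable_pi_lambda _ fun q => Measurable.matVec hQi
        ((measurable_pi_apply q).comp ((measurable_simData k).comp hy))
    · exact (measurable_simVec e k).comp measurable_snd
  refine Measurable.ite ?_ (measurable_householder.comp hw) measurable_const
  rw [Set.ofPred_forall]
  refine MeasurableSet.iInter fun q => ?_
  exact (hw.inner ((measurable_pi_apply q).comp hy)) (measurableSet_singleton 0)

theorem measurable_stepRot_comp {α : Type*} [MeasurableSpace α] (A : AdaptiveAlgorithm d K)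
    (e : Vec d) (k : Fin K) {Q : α → O(d)} {y : α → H k → Vec d} {z : α → Vec d}
    (hQ : Measurable Q) (hy : Measurable y) (hz : Measurable z) :
    Measurable fun a => stepRot A e k (Q a) (y a) (z a) :=
  Measurable.comp (g := fun p : O(d) × (H k → Vec d) × Vec d => stepRot A e k p.1 p.2.1 p.2.2)
    (f := fun a => (Q a, y a, z a)) (measurable_stepRot A e k) (hQ.prodMk (hy.prodMk hz))

theorem act_stepRot (A : AdaptiveAlgorithm d K) (e : Vec d) (k : Fin K) (Q : O(d))
    (y : H k → Vec d) (z : Vec d) (p : H k) : act (stepRot A e k Q y z) (y p) = y p := by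
  unfold stepRot
  simp only
  split_ifs with h
  · exact act_householder_of_inner_eq_zero (h p)
  · exact act_one _

/-- The product of the first `k` simulated rotations, as a function of `{M^i z_j}_{H_k}`. -/
noncomputable def simRot (A : AdaptiveAlgorithm d K) (e : Vec d) : (k : ℕ) → (H k → Vec d) → O(d)
  | 0, _ => 1
  | k + 1, y =>
    (if h : k < K then
      stepRot A e ⟨k, h⟩ (simRot A e k (restr k.le_succ y)) (restr k.le_succ y)
        (y (idx 0 k (by omega) k.lt_succ_self))
    else 1) * simRot A e k (restr k.le_succ y)

theorem measurable_simRot (A : AdaptiveAlgorithm d K) (e : Vec d) (k : ℕ) :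
    Measurable (simRot A e k) := by
  induction k with
  | zero => exact measurable_const
  | succ k ih =>
    have h1 : Measurable fun y : H (k + 1) → Vec d => simRot A e k (restr k.le_succ y) :=
      ih.comp (measurable_restr k.le_succ)
    have hs : simRot A e (k + 1) = fun y => (if h : k < K then
        stepRot A e ⟨k, h⟩ (simRot A e k (restr k.le_succ y)) (restr k.le_succ y)
          (y (idx 0 k (by omega) k.lt_succ_self))
        else 1) * simRot A e k (restr k.le_succ y) := by
      funext y
      rw [simRot]
    rw [hs]
    refine Measurable.fun_mul ?_ h1
    split_ifs with h
    · exact measurable_stepRot_comp A e ⟨k, h⟩ h1 (measurable_restr k.le_succ)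
        (measurable_pi_apply _)
    · exact measurable_const

/-- The simulated rotation in step `k`. -/
noncomputable def simStep (A : AdaptiveAlgorithm d K) (e : Vec d) (k : Fin K) (y : H k → Vec d)
    (z : Vec d) : O(d) :=
  (simRot A e k y)⁻¹ * stepRot A e k (simRot A e k y) y z * simRot A e k y

theorem measurable_simStep (A : AdaptiveAlgorithm d K) (e : Vec d) (k : Fin K) :
    Measurable (Function.uncurry (simStep A e k)) := by
  have h1 : Measurable fun p : (H k → Vec d) × Vec d => simRot A e k p.1 :=
    (measurable_simRot A e k).comp measurable_fst
  have h2 : Measurable fun p : (H k → Vec d) × Vec d =>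
      stepRot A e k (simRot A e k p.1) p.1 p.2 :=
    measurable_stepRot_comp A e k h1 measurable_fst measurable_snd
  exact (h1.inv.fun_mul h2).fun_mul h1

theorem simRot_succ_krylov (A : AdaptiveAlgorithm d K) (e : Vec d)
    (M : Matrix (Fin d) (Fin d) ℝ) (z : Fin K → Vec d) (k : ℕ) (hk : k < K) :
    simRot A e (k + 1) (krylov M z (k + 1) hk) =
      stepRot A e ⟨k, hk⟩ (simRot A e k (krylov M z k hk.le)) (krylov M z k hk.le) (z ⟨k, hk⟩) *
        simRot A e k (krylov M z k hk.le) := by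
  rw [simRot, dif_pos hk, restr_krylov, krylov_idx, pow_zero, act_one]

/-- Step rotations accumulate on the left, while the product of the `Ũ_k` grows on the right;
conjugation by the previous product reconciles the two orders. -/
theorem prod_simStep_aux (A : AdaptiveAlgorithm d K) (e : Vec d)
    (M : Matrix (Fin d) (Fin d) ℝ) (z : Fin K → Vec d) (n : ℕ) (hn : n ≤ K) :
    (List.ofFn fun k : Fin n => fromKrylov (simStep A e) M z (Fin.castLE hn k)).prod =
      simRot A e n (krylov M z n hn) := by
  induction n with
  | zero => simp [simRot]
  | succ n ih =>
    rw [List.ofFn_succ', List.concat_eq_append, List.prod_append, List.prod_singleton,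
      simRot_succ_krylov]
    have := ih (Nat.le_of_succ_le hn)
    simp only [Fin.castLE_castSucc] at this ⊢
    rw [this, fromKrylov, simStep, mul_assoc]
    exact mul_inv_cancel_left _ _

theorem prod_simStep (A : AdaptiveAlgorithm d K) (e : Vec d)
    (M : Matrix (Fin d) (Fin d) ℝ) (z : Fin K → Vec d) :
    (List.ofFn (fromKrylov (simStep A e) M z)).prod = simRot A e K (krylov M z K le_rfl) :=
  prod_simStep_aux A e M z K le_rfl

end Simulation

/-! ### The deterministic identity between simulated data and queries -/

section Pointwise

variable {d K : ℕ}

local notation "O(" d ")" => Matrix.orthogonalGroup (Fin d) ℝ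

/-- None of the vectors `y (0, j)` is in the span of the data known before. -/
def Nondegenerate {k : ℕ} (y : H k → Vec d) : Prop :=
  ∀ j : Fin k, resid j (restr j.isLt.le y) (y (idx 0 j (by omega) j.isLt)) ≠ 0

theorem Nondegenerate.restr {k j : ℕ} {y : H k → Vec d} (hy : Nondegenerate y) (h : j ≤ k) :
    Nondegenerate (restr h y) :=
  fun i => hy (Fin.castLE h i)

theorem Nondegenerate.resid_ne_zero {M : Matrix (Fin d) (Fin d) ℝ} {z : Fin K → Vec d}
    (h : Nondegenerate (krylov M z K le_rfl)) (k : Fin K) :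
    resid k (krylov M z k k.isLt.le) (z k) ≠ 0 := by
  have := h k
  rwa [krylov_idx, pow_zero, act_one] at this

theorem simVec_of_ne_zero {e : Vec d} {k : ℕ} {y : H k → Vec d} {z : Vec d}
    (h : resid k y z ≠ 0) : simVec e k y z = ‖resid k y z‖⁻¹ • resid k y z :=
  if_neg h

theorem krylov_simVec {e : Vec d} {M : Matrix (Fin d) (Fin d) ℝ} {z : Fin K → Vec d}
    (h : Nondegenerate (krylov M z K le_rfl)) (k : ℕ) (hk : k ≤ K) :
    krylov M (fromKrylov (fun k => simVec e k) M z) k hk = simData k (krylov M z k hk) := by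
  funext p
  have h0 := h.resid_ne_zero (Fin.castLE hk p.1.2)
  rw [krylov, fromKrylov, simVec_of_ne_zero h0, simData, restr_krylov, krylov_idx, pow_zero,
    act_one, act_smul]
  congr 1
  rw [resid, act_sub, act_sum]
  congr 1
  refine Finset.sum_congr rfl fun q _ => ?_
  rw [act_smul, krylov_idx, krylov, act_act, ← pow_add]
  simp only [pow_zero, act_one]
  rfl

/-- The passage from `y` to `simData k y` is triangular in the query number `j`, with nonzero
diagonal factors by nondegeneracy, so it can be inverted by induction on `j`. -/
theorem inner_eq_zero_of_inner_simData_eq_zero {k : ℕ} {y : H k → Vec d} (hy : Nondegenerate y)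
    {u : Vec d} (hu : ∀ p, inner ℝ u (simData k y p) = 0) (p : H k) : inner ℝ u (y p) = 0 := by
  induction hj : (p.1.2 : ℕ) using Nat.strong_induction_on generalizing p with
  | _ j ih =>
    have h1 := hu p
    have h2 := inv_ne_zero (norm_ne_zero_iff.mpr (hy p.1.2))
    rw [simData, inner_smul_right, mul_eq_zero, or_iff_right h2, inner_sub_right, inner_sum] at h1
    rw [sub_eq_zero] at h1
    rw [h1]
    refine Finset.sum_eq_zero fun q _ => ?_
    rw [inner_smul_right, ih q.1.2 (hj ▸ q.1.2.isLt) _ rfl, mul_zero]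

theorem act_simData_eq_self {k : ℕ} {y : H k → Vec d} {M : Matrix (Fin d) (Fin d) ℝ}
    (hM : ∀ p, act M (y p) = y p) (p : H k) : act M (simData k y p) = simData k y p := by
  simp only [simData, act_smul, act_sub, act_sum, hM]

/-- The algorithm cannot tell `L` from `V⁻¹ L V` if `V` fixes all it has seen. The range `j ≤ k`
includes the query number `k` (counted from `0`), as it depends only on data indexed by `H k`. -/
theorem query_rotM {A : AdaptiveAlgorithm d K} {L : Matrix (Fin d) (Fin d) ℝ} {V : O(d)} {k : ℕ}
    {hk : k ≤ K} (hV : ∀ p, act V (krylov L (A.query L) k hk p) = krylov L (A.query L) k hk p)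
    (j : ℕ) (hj : j ≤ k) (hjK : j < K) :
    A.query (rotM V⁻¹ L) ⟨j, hjK⟩ = A.query L ⟨j, hjK⟩ := by
  have hV' (p : H k) : act ((V⁻¹ : O(d)) : Matrix (Fin d) (Fin d) ℝ)
      (krylov L (A.query L) k hk p) = krylov L (A.query L) k hk p := by
    conv_lhs => rw [← hV p]
    exact act_inv_act _ _
  induction j using Nat.strong_induction_on with
  | _ j ih =>
    rw [A.query_eq, A.query_eq]
    congr 1
    funext q
    have hq : (q.1.2 : ℕ) < j := q.1.2.isLt
    have hx : A.query L ⟨q.1.2, hq.trans hjK⟩ =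
        act ((V⁻¹ : O(d)) : Matrix (Fin d) (Fin d) ℝ) (A.query L ⟨q.1.2, hq.trans hjK⟩) := by
      have := hV' (idx 0 q.1.2 (by omega) (by omega))
      rw [krylov_idx, pow_zero, act_one] at this
      exact this.symm
    have h1 : krylov (rotM V⁻¹ L) (A.query (rotM V⁻¹ L)) j hjK.le q =
        act (rotM V⁻¹ L ^ (q.1.1 : ℕ)) (A.query (rotM V⁻¹ L) ⟨q.1.2, hq.trans hjK⟩) := rfl
    refine h1.trans ?_
    rw [ih q.1.2 hq (by omega) (hq.trans hjK), hx, act_rotM_pow]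
    exact hV' (idx q.1.1 q.1.2 (q.2.trans hj) (by omega))

/-- An instance of `query_rotM` with `V = Q⁻¹ W Q`: this fixes `Q⁻¹ s` because `W` fixes `s`. -/
theorem query_rotM_mul {A : AdaptiveAlgorithm d K} {M : Matrix (Fin d) (Fin d) ℝ} {Q W : O(d)}
    {k : ℕ} {hk : k ≤ K} {s : H k → Vec d} (hW : ∀ p, act W (s p) = s p)
    (hs : krylov (rotM Q⁻¹ M) (A.query (rotM Q⁻¹ M)) k hk =
      fun p => act ((Q⁻¹ : O(d)) : Matrix (Fin d) (Fin d) ℝ) (s p))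
    (j : ℕ) (hj : j ≤ k) (hjK : j < K) :
    A.query (rotM (W * Q)⁻¹ M) ⟨j, hjK⟩ = A.query (rotM Q⁻¹ M) ⟨j, hjK⟩ := by
  have hconj : rotM (W * Q)⁻¹ M = rotM (Q⁻¹ * W * Q)⁻¹ (rotM Q⁻¹ M) := by
    rw [← rotM_mul]
    congr 1
    simp only [mul_inv_rev, inv_inv, mul_assoc, mul_inv_cancel, mul_one]
  rw [hconj]
  refine query_rotM (k := k) (hk := hk) (fun p => ?_) j hj hjK
  rw [hs]
  simp only [coe_mul_orth, ← act_act, act_act_inv, hW]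

/-- The matrix `M` rotated back by the first `k` simulated rotations. -/
noncomputable def rotatedMatrix (A : AdaptiveAlgorithm d K) (e : Vec d) (k : ℕ) (hk : k ≤ K)
    (M : Matrix (Fin d) (Fin d) ℝ) (z : Fin K → Vec d) : Matrix (Fin d) (Fin d) ℝ :=
  rotM (simRot A e k (krylov M z k hk))⁻¹ M

/-- Induction on `k`. The new reflection fixes the old simulated data, so the old queries stay
correct, and it is built to correct the new one. Orthonormality on each intermediate matrix ensures
that the reflection is really used. -/
theorem query_rotatedMatrix (A : AdaptiveAlgorithm d K) {e : Vec d} (he : ‖e‖ = 1)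
    {M : Matrix (Fin d) (Fin d) ℝ} {z : Fin K → Vec d}
    (h : Nondegenerate (krylov M z K le_rfl))
    (hA : ∀ k hk, A.OrthonormalOn (rotatedMatrix A e k hk M z)) (k : ℕ) (hk : k ≤ K) :
    ∀ j (hj : j < k), A.query (rotatedMatrix A e k hk M z) ⟨j, hj.trans_le hk⟩ =
      act (((simRot A e k (krylov M z k hk))⁻¹ : O(d)) : Matrix (Fin d) (Fin d) ℝ)
        (fromKrylov (fun k => simVec e k) M z ⟨j, hj.trans_le hk⟩) := by
  induction k with
  | zero => intro j hj; omega
  | succ k ih =>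
    have hkK : k < K := hk
    specialize ih hkK.le
    have hA' := hA k hkK.le
    have hsucc : rotatedMatrix A e (k + 1) hk M z =
        rotM (simRot A e (k + 1) (krylov M z (k + 1) hk))⁻¹ M := rfl
    rw [hsucc, simRot_succ_krylov A e M z k hkK]
    have hL : rotatedMatrix A e k hkK.le M z = rotM (simRot A e k (krylov M z k hkK.le))⁻¹ M := rfl
    have hsim := krylov_simVec (e := e) h k hkK.le
    have hnd : Nondegenerate (krylov M z k hkK.le) := h.restr hkK.le
    have hr := h.resid_ne_zero ⟨k, hkK⟩
    set y := krylov M z k hkK.le with hy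
    set Q := simRot A e k y with hQ
    set L := rotatedMatrix A e k hkK.le M z with hLdef
    set W := stepRot A e ⟨k, hkK⟩ Q y (z ⟨k, hkK⟩) with hW
    have hWfix : ∀ p, act W (simData k y p) = simData k y p :=
      act_simData_eq_self fun p => act_stepRot A e ⟨k, hkK⟩ Q y (z ⟨k, hkK⟩) p
    have hdata : krylov L (A.query L) k hkK.le =
        fun p => act ((Q⁻¹ : O(d)) : Matrix (Fin d) (Fin d) ℝ) (simData k y p) := by
      funext p
      have h1 : krylov L (A.query L) k hkK.le p =
        act (L ^ (p.1.1 : ℕ)) (A.query L ⟨p.1.2, p.1.2.isLt.trans hkK⟩) := rfl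
      rw [h1, ih p.1.2 p.1.2.isLt, hL, act_rotM_pow, ← hsim]
      rfl
    have hq := query_rotM_mul (W := W) hWfix (hL ▸ hdata)
    have hinv (x : Vec d) : act (((W * Q)⁻¹ : O(d)) : Matrix (Fin d) (Fin d) ℝ) x =
        act ((Q⁻¹ : O(d)) : Matrix (Fin d) (Fin d) ℝ)
          (act ((W⁻¹ : O(d)) : Matrix (Fin d) (Fin d) ℝ) x) := by
      rw [mul_inv_rev, coe_mul_orth, act_act]
    intro j hj
    rw [hinv, hq j (by omega) (by omega), ← hL]
    rcases (Nat.lt_succ_iff_lt_or_eq.mp hj) with hjk | rfl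
    · rw [ih j hjk]
      congr 1
      have h1 : fromKrylov (fun k => simVec e k) M z ⟨j, by omega⟩ =
          simData k y (idx 0 j (by omega) hjk) := by
        rw [← hsim, krylov_idx, pow_zero, act_one]
      rw [h1]
      conv_rhs => rw [← hWfix]
      rw [act_inv_act]
    · have hn : A.query L ⟨j, hkK⟩ = A.next ⟨j, hkK⟩ fun p =>
          act ((Q⁻¹ : O(d)) : Matrix (Fin d) (Fin d) ℝ) (simData j y p) := by
        rw [A.query_eq]
        congr 1
      have hort := (hA' ⟨j, hkK⟩).2
      have hnorm := (hA' ⟨j, hkK⟩).1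
      -- This is the test in `stepRot`: the query is orthogonal to the simulated data, hence to `y`
      -- by triangularity; the simulated vector is so by construction.
      have hw : ∀ p, inner ℝ (act Q (A.query L ⟨j, hkK⟩) - simVec e j y (z ⟨j, hkK⟩)) (y p) = 0 := by
        intro p
        have h1 : inner ℝ (act Q (A.query L ⟨j, hkK⟩)) (y p) = 0 := by
          refine inner_eq_zero_of_inner_simData_eq_zero hnd (fun p => ?_) p
          rw [inner_act_left, ← coe_inv_eq_transpose]
          have h2 := hort p
          change inner ℝ _ (krylov L (A.query L) j hkK.le p) = 0 at h2
          rwa [hdata] at h2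
        have h3 : inner ℝ (simVec e j y (z ⟨j, hkK⟩)) (y p) = 0 := by
          rw [simVec_of_ne_zero hr, inner_smul_left]
          have := inner_resid j y (z ⟨j, hkK⟩) p
          simp only [this, mul_zero]
        rw [inner_sub_left, h1, h3, sub_zero]
      have hWh : W = householder (act Q (A.query L ⟨j, hkK⟩) - simVec e j y (z ⟨j, hkK⟩)) := by
        rw [hW, hn]
        rw [hn] at hw
        exact if_pos hw
      have hswap : act W (act Q (A.query L ⟨j, hkK⟩)) = simVec e j y (z ⟨j, hkK⟩) := by
        rw [hWh]
        refine act_householder_sub ?_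
        rw [norm_act, norm_simVec he]
        exact hnorm
      change _ = act _ (act _ (simVec e j y (z ⟨j, hkK⟩)))
      rw [← hswap, act_inv_act, act_inv_act]

theorem rotateBack_eq_krylov_query (A : AdaptiveAlgorithm d K) {e : Vec d} (he : ‖e‖ = 1)
    {M : Matrix (Fin d) (Fin d) ℝ} {z : Fin K → Vec d}
    (h : Nondegenerate (krylov M z K le_rfl))
    (hA : ∀ k hk, A.OrthonormalOn (rotatedMatrix A e k hk M z)) :
    rotateBack (fromKrylov (simStep A e) M z)
        (krylov M (fromKrylov (fun k => simVec e k) M z) K le_rfl) =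
      krylov (rotatedMatrix A e K le_rfl M z) (A.query (rotatedMatrix A e K le_rfl M z)) K
        le_rfl := by
  funext p
  have h1 := query_rotatedMatrix A he h hA K le_rfl p.1.2 p.1.2.isLt
  have h2 : krylov (rotatedMatrix A e K le_rfl M z) (A.query (rotatedMatrix A e K le_rfl M z)) K
      le_rfl p = act (rotatedMatrix A e K le_rfl M z ^ (p.1.1 : ℕ))
        (A.query (rotatedMatrix A e K le_rfl M z) ⟨p.1.2, p.1.2.isLt⟩) := rfl
  rw [h2, h1, rotatedMatrix, act_rotM_pow, rotateBack, prod_simStep]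
  rfl

end Pointwise

/-! ### Measurability of the queries and of the rotated matrices -/

section Measurability

variable {d K : ℕ}

local notation "O(" d ")" => Matrix.orthogonalGroup (Fin d) ℝ

theorem Measurable.matPow {α : Type*} [MeasurableSpace α] {M : α → Matrix (Fin d) (Fin d) ℝ}
    (hM : Measurable M) (i : ℕ) : Measurable fun a => M a ^ i :=
  Measurable.comp (g := fun N : Matrix (Fin d) (Fin d) ℝ => N ^ i) (f := M)
    (continuous_pow i).measurable hM

theorem measurable_krylov {α : Type*} [MeasurableSpace α] {M : α → Matrix (Fin d) (Fin d) ℝ}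
    {x : α → Fin K → Vec d} (hM : Measurable M) (hx : Measurable x) (k : ℕ) (hk : k ≤ K) :
    Measurable fun a => krylov (M a) (x a) k hk :=
  measurable_pi_lambda _ fun _ =>
    Measurable.matVec (hM.matPow _) ((measurable_pi_apply _).comp hx)

theorem measurable_query (A : AdaptiveAlgorithm d K) (k : ℕ) (hk : k < K) :
    Measurable fun M => A.query M ⟨k, hk⟩ := by
  induction k using Nat.strong_induction_on with
  | _ k ih =>
    simp only [A.query_eq]
    refine (A.measurable_next ⟨k, hk⟩).comp (measurable_pi_lambda _ fun p => ?_)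
    exact Measurable.matVec (measurable_id.matPow _)
      (ih p.1.2 p.1.2.isLt (p.1.2.isLt.trans hk))

theorem measurable_query_family (A : AdaptiveAlgorithm d K) : Measurable fun M => A.query M :=
  measurable_pi_lambda _ fun k => measurable_query A k k.isLt

theorem measurableSet_orthonormalOn (A : AdaptiveAlgorithm d K) :
    MeasurableSet {M | A.OrthonormalOn M} := by
  have hq (k : Fin K) : Measurable fun M => A.query M k := measurable_query A k k.isLt
  unfold AdaptiveAlgorithm.OrthonormalOn
  rw [Set.ofPred_forall]
  refine MeasurableSet.iInter fun k => MeasurableSet.inter ?_ ?_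
  · exact (hq k).norm (measurableSet_singleton 1)
  · have : MeasurableSet {M | ∀ p : H k,
        inner ℝ (A.query M k) (krylov M (A.query M) k k.isLt.le p) = 0} := by
      rw [Set.ofPred_forall]
      refine MeasurableSet.iInter fun p => ?_
      exact ((hq k).inner ((measurable_pi_apply p).comp
        (measurable_krylov measurable_id (measurable_query_family A) k k.isLt.le)))
        (measurableSet_singleton 0)
    exact this

theorem measurable_rotatedMatrix (A : AdaptiveAlgorithm d K) (e : Vec d) (k : ℕ) (hk : k ≤ K) :
    Measurable fun x : Matrix (Fin d) (Fin d) ℝ × (Fin K → Vec d) =>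
      rotatedMatrix A e k hk x.1 x.2 := by
  have h1 : Measurable fun x : Matrix (Fin d) (Fin d) ℝ × (Fin K → Vec d) =>
      simRot A e k (krylov x.1 x.2 k hk) :=
    (measurable_simRot A e k).comp (measurable_krylov measurable_fst measurable_snd k hk)
  exact Measurable.matConj h1.inv measurable_fst

end Measurability

/-! ### Almost sure nondegeneracy -/

section Gaussian

variable {d K : ℕ}

theorem stdGaussian_inner_eq_zero {n : Vec d} (hn : n ≠ 0) :
    stdGaussian (Vec d) {z | inner ℝ n z = 0} = 0 := by
  have h1 := IsGaussian.map_eq_gaussianReal (μ := stdGaussian (Vec d)) (innerSL ℝ n)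
  rw [variance_dual_stdGaussian] at h1
  have h2 : (‖innerSL ℝ n‖ ^ 2).toNNReal ≠ 0 := by
    simpa [Real.toNNReal_eq_zero] using hn
  have := nullSingletonClass_gaussianReal (μ := (stdGaussian (Vec d))[innerSL ℝ n]) h2
  have h3 : (stdGaussian (Vec d)).map (innerSL ℝ n) {0} = 0 := by
    rw [h1]
    exact measure_singleton 0
  rwa [Measure.map_apply (innerSL ℝ n).continuous.measurable (measurableSet_singleton 0)] at h3

/-- `H k` has at most `(k + 1) * k` elements, so the span of `y` is proper and lies in a hyperplane,
which is Gaussian-null. -/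
theorem stdGaussian_resid_eq_zero {k : ℕ} (hk : (k + 1) * k < d) (y : H k → Vec d) :
    stdGaussian (Vec d) {z | resid k y z = 0} = 0 := by
  set V := Submodule.span ℝ (Set.range y) with hV
  have hcard : Fintype.card (H k) ≤ (k + 1) * k := by
    refine (Fintype.card_subtype_le _).trans ?_
    simp
  have hV1 : V ≠ ⊤ := fun h => by
    have h1 := finrank_range_le_card (R := ℝ) y
    rw [Set.finrank, ← hV, h, finrank_top, finrank_euclideanSpace, Fintype.card_fin] at h1
    omega
  have hV2 : Vᗮ ≠ ⊥ := fun h => hV1 (Submodule.orthogonal_eq_bot_iff.mp h)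
  obtain ⟨n, hn, hn0⟩ := Submodule.exists_mem_ne_zero_of_ne_bot hV2
  refine measure_mono_null (fun z hz => ?_) (stdGaussian_inner_eq_zero hn0)
  have hz' : z = ∑ q, projCoeff k y z q • y q := sub_eq_zero.mp hz
  have hzV : z ∈ V := by
    rw [hz']
    exact Submodule.sum_mem _ fun q _ =>
      Submodule.smul_mem _ _ (Submodule.subset_span (Set.mem_range_self q))
  exact (Submodule.mem_orthogonal' V n).mp hn z hzV

theorem krylov_update_of_le {M : Matrix (Fin d) (Fin d) ℝ} {z : Fin K → Vec d} (k : Fin K)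
    (w : Vec d) :
    krylov M (Function.update z k w) k k.isLt.le = krylov M z k k.isLt.le := by
  funext p
  have hp : Fin.castLE k.isLt.le p.1.2 ≠ k := fun h => by
    have h1 := congrArg Fin.val h
    have h2 := p.1.2.isLt
    simp only [Fin.val_castLE] at h1
    omega
  rw [krylov, krylov, Function.update_of_ne hp]

theorem ae_nondegenerate (hK : K ^ 2 < d) (lam : Measure (Matrix (Fin d) (Fin d) ℝ))
    [IsProbabilityMeasure lam] :
    ∀ᵐ x ∂(lam.prod (Measure.pi fun _ : Fin K => stdGaussian (Vec d))),
      Nondegenerate (krylov x.1 x.2 K le_rfl) := by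
  have hkey (k : Fin K) : ∀ᵐ x ∂(lam.prod (Measure.pi fun _ : Fin K => stdGaussian (Vec d))),
      resid k (krylov x.1 x.2 k k.isLt.le) (x.2 k) ≠ 0 := by
    have hm : Measurable fun x : Matrix (Fin d) (Fin d) ℝ × (Fin K → Vec d) =>
        resid k (krylov x.1 x.2 k k.isLt.le) (x.2 k) :=
      (measurable_resid k).comp ((measurable_krylov measurable_fst measurable_snd _ _).prodMk
        ((measurable_pi_apply k).comp measurable_snd))
    have hs : MeasurableSet {x : Matrix (Fin d) (Fin d) ℝ × (Fin K → Vec d) |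
        resid k (krylov x.1 x.2 k k.isLt.le) (x.2 k) = 0} := hm (measurableSet_singleton 0)
    rw [ae_iff]
    simp only [ne_eq, not_not]
    rw [Measure.measure_prod_null hs]
    refine Filter.Eventually.of_forall fun M => ?_
    have hsM := measurable_prodMk_left (x := M) hs
    change (Measure.pi fun _ : Fin K => stdGaussian (Vec d)) _ = 0
    rw [← lintegral_indicator_one hsM]
    have h0 : ∫⁻ _ : Fin K → Vec d, 0 ∂(Measure.pi fun _ : Fin K => stdGaussian (Vec d)) = 0 :=
      lintegral_zero
    rw [← h0]
    -- It is enough to integrate out `z k` alone, since the earlier Krylov data does not involve it.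
    refine lintegral_eq_of_lmarginal_eq {k} (measurable_one.indicator hsM) measurable_zero ?_
    rw [lmarginal_singleton, lmarginal_singleton]
    funext z
    rw [lintegral_zero]
    have hz : ∀ᵐ w ∂(stdGaussian (Vec d)), resid k (krylov M z k k.isLt.le) w ≠ 0 := by
      rw [ae_iff]
      simp only [ne_eq, not_not]
      refine stdGaussian_resid_eq_zero ?_ _
      have := k.isLt
      nlinarith
    refine (lintegral_congr_ae (hz.mono fun w hw => ?_)).trans lintegral_zero
    refine Set.indicator_of_notMem (fun hmem => hw ?_) _
    have h2 : resid k (krylov M (Function.update z k w) k k.isLt.le)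
      (Function.update z k w k) = 0 := hmem
    rwa [krylov_update_of_le, Function.update_self] at h2
  filter_upwards [ae_all_iff.mpr hkey] with x hx j
  rw [krylov_idx, pow_zero, act_one]
  exact hx j

end Gaussian

/-! ### Invariance of the law under the adaptive rotations -/

section Invariance

variable {d K : ℕ}

local notation "O(" d ")" => Matrix.orthogonalGroup (Fin d) ℝ

theorem continuous_act_left (x : Vec d) :
    Continuous fun g : O(d) => act (g : Matrix (Fin d) (Fin d) ℝ) x :=
  Continuous.comp (g := fun p : Matrix (Fin d) (Fin d) ℝ × Vec d => act p.1 p.2)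
    (f := fun g : O(d) => ((g : Matrix (Fin d) (Fin d) ℝ), x)) continuous_act
    (continuous_subtype_val.prodMk continuous_const)

/-- The action of an orthogonal matrix on a matrix and the first `k` of some vectors. -/
noncomputable def partialRot (k : ℕ) (g : O(d))
    (x : Matrix (Fin d) (Fin d) ℝ × (Fin K → Vec d)) :
    Matrix (Fin d) (Fin d) ℝ × (Fin K → Vec d) :=
  (rotM g x.1, fun j => if (j : ℕ) < k then act g (x.2 j) else x.2 j)

theorem measurable_partialRot (k : ℕ) :
    Measurable fun p : O(d) × Matrix (Fin d) (Fin d) ℝ × (Fin K → Vec d) =>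
      partialRot k p.1 p.2 := by
  refine Measurable.prodMk (Measurable.matConj measurable_fst (measurable_fst.comp measurable_snd))
    (measurable_pi_lambda _ fun j => ?_)
  have h2 : Measurable fun p : O(d) × Matrix (Fin d) (Fin d) ℝ × (Fin K → Vec d) => p.2.2 j :=
    (measurable_pi_apply j).comp (measurable_snd.comp measurable_snd)
  by_cases hj : (j : ℕ) < k
  · simp only [hj, if_true]
    exact Measurable.matVec (measurable_subtype_coe.comp measurable_fst) h2
  · simpa only [hj, if_false] using h2

theorem partialRot_mul (k : ℕ) (g h : O(d))
    (x : Matrix (Fin d) (Fin d) ℝ × (Fin K → Vec d)) :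
    partialRot k (g * h) x = partialRot k g (partialRot k h x) := by
  unfold partialRot
  simp only [rotM_mul, coe_mul_orth, Prod.mk.injEq, true_and]
  funext j
  split_ifs
  · rw [act_act]
  · rfl

theorem krylov_partialRot (k : ℕ) (hk : k ≤ K) (g : O(d))
    (x : Matrix (Fin d) (Fin d) ℝ × (Fin K → Vec d)) :
    krylov (partialRot k g x).1 (partialRot k g x).2 k hk =
      fun p => act g (krylov x.1 x.2 k hk p) := by
  funext p
  have hp : ((Fin.castLE hk p.1.2 : Fin K) : ℕ) < k := p.1.2.isLt
  simp only [krylov, partialRot, if_pos hp, act_rotM_pow]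

theorem map_act_stdGaussian (g : O(d)) :
    (stdGaussian (Vec d)).map (act (g : Matrix (Fin d) (Fin d) ℝ)) = stdGaussian (Vec d) :=
  stdGaussian_map (actIsometry g)

theorem map_partialRot {lam : Measure (Matrix (Fin d) (Fin d) ℝ)} [IsProbabilityMeasure lam]
    (hlam : ∀ g : O(d), lam.map (rotM g) = lam) (k : ℕ) (g : O(d)) :
    (lam.prod (Measure.pi fun _ : Fin K => stdGaussian (Vec d))).map (partialRot k g) =
      lam.prod (Measure.pi fun _ : Fin K => stdGaussian (Vec d)) := by
  have h1 : MeasurePreserving (rotM g) lam lam :=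
    ⟨Measurable.matConj measurable_const measurable_id, hlam g⟩
  have h2 : MeasurePreserving
      (fun (z : Fin K → Vec d) (j : Fin K) =>
        if (j : ℕ) < k then act (g : Matrix (Fin d) (Fin d) ℝ) (z j) else z j)
      (Measure.pi fun _ => stdGaussian (Vec d)) (Measure.pi fun _ => stdGaussian (Vec d)) := by
    refine measurePreserving_pi (fun _ : Fin K => stdGaussian (Vec d)) (fun _ => stdGaussian (Vec d))
      (f := fun (j : Fin K) w => if (j : ℕ) < k then act (g : Matrix (Fin d) (Fin d) ℝ) w else w)
      fun j => ?_
    by_cases hj : (j : ℕ) < k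
    · simp only [hj, if_true]
      exact ⟨Measurable.matVec measurable_const measurable_id, map_act_stdGaussian g⟩
    · simp only [hj, if_false]
      exact MeasurePreserving.id _
  exact (h1.prod h2).map_eq

/-- The inverse of the rotation made in step `k`, as a function of the matrix and the vectors. -/
noncomputable def stepInv (A : AdaptiveAlgorithm d K) (e : Vec d) (k : Fin K)
    (x : Matrix (Fin d) (Fin d) ℝ × (Fin K → Vec d)) : O(d) :=
  (stepRot A e k (simRot A e k (krylov x.1 x.2 k k.isLt.le)) (krylov x.1 x.2 k k.isLt.le)
    (x.2 k))⁻¹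

theorem measurable_stepInv (A : AdaptiveAlgorithm d K) (e : Vec d) (k : Fin K) :
    Measurable (stepInv A e k) := by
  have h1 : Measurable fun x : Matrix (Fin d) (Fin d) ℝ × (Fin K → Vec d) =>
      krylov x.1 x.2 k k.isLt.le := measurable_krylov measurable_fst measurable_snd _ _
  have h2 : Measurable fun x : Matrix (Fin d) (Fin d) ℝ × (Fin K → Vec d) =>
      simRot A e k (krylov x.1 x.2 k k.isLt.le) := (measurable_simRot A e k).comp h1
  have h3 : Measurable fun x : Matrix (Fin d) (Fin d) ℝ × (Fin K → Vec d) => x.2 k :=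
    (measurable_pi_apply _).comp measurable_snd
  exact (measurable_stepRot_comp A e k h2 h1 h3).inv

theorem act_stepInv (A : AdaptiveAlgorithm d K) (e : Vec d) (k : Fin K)
    (x : Matrix (Fin d) (Fin d) ℝ × (Fin K → Vec d)) (p : H k) :
    act (stepInv A e k x : Matrix (Fin d) (Fin d) ℝ) (krylov x.1 x.2 k k.isLt.le p) =
      krylov x.1 x.2 k k.isLt.le p := by
  have h1 := act_stepRot A e k (simRot A e k (krylov x.1 x.2 k k.isLt.le))
    (krylov x.1 x.2 k k.isLt.le) (x.2 k) p
  conv_lhs => rw [← h1]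
  exact act_inv_act _ _

/-- Rotating by `stepInv` leaves the Krylov data unchanged, hence also the previous product `Q`, so
the two conjugations compose. -/
theorem rotatedMatrix_succ (A : AdaptiveAlgorithm d K) (e : Vec d) (k : Fin K)
    (x : Matrix (Fin d) (Fin d) ℝ × (Fin K → Vec d)) :
    rotatedMatrix A e (k + 1) k.isLt x.1 x.2 =
      rotatedMatrix A e k k.isLt.le (partialRot k (stepInv A e k x) x).1
        (partialRot k (stepInv A e k x) x).2 := by
  rw [rotatedMatrix, rotatedMatrix, krylov_partialRot]
  simp only [act_stepInv]
  rw [simRot_succ_krylov, mul_inv_rev, rotM_mul]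
  rfl

/-- The stabilizer lemma, with `π` the Krylov data of the first `k` Gaussians, which is equivariant
under `partialRot k`. -/
theorem map_partialRot_stepInv (A : AdaptiveAlgorithm d K) (e : Vec d)
    {lam : Measure (Matrix (Fin d) (Fin d) ℝ)} [IsProbabilityMeasure lam]
    (hlam : ∀ g : O(d), lam.map (rotM g) = lam) (k : Fin K) :
    (lam.prod (Measure.pi fun _ : Fin K => stdGaussian (Vec d))).map
        (fun x => partialRot k (stepInv A e k x) x) =
      lam.prod (Measure.pi fun _ : Fin K => stdGaussian (Vec d)) := by
  refine map_stabilizer_eq (G := O(d)) (Y := H k → Vec d) (a := partialRot k)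
    (b := fun g y p => act (g : Matrix (Fin d) (Fin d) ℝ) (y p))
    (π := fun x => krylov x.1 x.2 k k.isLt.le) (W := stepInv A e k)
    (measurable_partialRot k) (partialRot_mul k) (fun y => ?_) (fun y => ?_) (fun g h y => ?_)
    (krylov_partialRot k k.isLt.le) (map_partialRot hlam k) (measurable_stepInv A e k)
    (fun x => funext (act_stepInv A e k x)) (fun x s hs => ?_)
  · exact continuous_pi fun p => continuous_act_left (y p)
  · exact funext fun p => act_one _
  · exact funext fun p => (act_act _ _ _).symm
  -- `stepInv` depends only on the Krylov data, which `s` fixes, and on `x.2 k`, which `partialRot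
  -- k` does not touch.
  · have h1 := (krylov_partialRot k k.isLt.le s x).trans hs
    have h2 : (partialRot k s x).2 k = x.2 k := if_neg (lt_irrefl _)
    rw [stepInv, h1, h2]
    rfl

theorem map_rotatedMatrix (A : AdaptiveAlgorithm d K) (e : Vec d)
    {lam : Measure (Matrix (Fin d) (Fin d) ℝ)} [IsProbabilityMeasure lam]
    (hlam : ∀ g : O(d), lam.map (rotM g) = lam) (k : ℕ) (hk : k ≤ K) :
    (lam.prod (Measure.pi fun _ : Fin K => stdGaussian (Vec d))).map
      (fun x => rotatedMatrix A e k hk x.1 x.2) = lam := by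
  induction k with
  | zero =>
    simp only [rotatedMatrix, simRot, inv_one, rotM_one]
    exact measurePreserving_fst.map_eq
  | succ k ih =>
    have hkK : k < K := hk
    have hT : Measurable fun x : Matrix (Fin d) (Fin d) ℝ × (Fin K → Vec d) =>
        partialRot k (stepInv A e ⟨k, hkK⟩ x) x :=
      Measurable.comp (g := fun p : O(d) × Matrix (Fin d) (Fin d) ℝ × (Fin K → Vec d) =>
        partialRot k p.1 p.2) (f := fun x => (stepInv A e ⟨k, hkK⟩ x, x))
        (measurable_partialRot k) ((measurable_stepInv A e ⟨k, hkK⟩).prodMk measurable_id)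
    have hcomp : (fun x : Matrix (Fin d) (Fin d) ℝ × (Fin K → Vec d) =>
        rotatedMatrix A e (k + 1) hk x.1 x.2) =
        (fun x => rotatedMatrix A e k hkK.le x.1 x.2) ∘
          fun x => partialRot k (stepInv A e ⟨k, hkK⟩ x) x :=
      funext fun x => rotatedMatrix_succ A e ⟨k, hkK⟩ x
    rw [hcomp, ← Measure.map_map (measurable_rotatedMatrix A e k hkK.le) hT,
      map_partialRot_stepInv A e hlam ⟨k, hkK⟩]
    exact ih hkK.le

end Invariance

/-! ### Conjugation invariance of the law of the random matrix -/

section Rotation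

variable {d K : ℕ}

local notation "O(" d ")" => Matrix.orthogonalGroup (Fin d) ℝ

theorem rotM_rotatedDiag (g U : O(d)) (D : Fin d → ℝ) :
    rotM g (rotatedDiag U D) = rotatedDiag (U * g⁻¹) D := by
  rw [rotM, rotatedDiag, rotatedDiag, ← coe_inv_eq_transpose, ← coe_inv_eq_transpose, mul_inv_rev,
    inv_inv, coe_mul_orth, coe_mul_orth]
  simp only [mul_assoc]

theorem measurable_rotatedDiag :
    Measurable fun p : O(d) × (Fin d → ℝ) => rotatedDiag p.1 p.2 := by
  have h1 : Continuous fun p : O(d) × (Fin d → ℝ) => rotatedDiag p.1 p.2 := by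
    have hU : Continuous fun p : O(d) × (Fin d → ℝ) => (p.1 : Matrix (Fin d) (Fin d) ℝ) :=
      continuous_subtype_val.comp continuous_fst
    exact (hU.matrix_transpose.matrix_mul continuous_snd.matrix_diagonal).matrix_mul hU
  exact h1.measurable

/-- Conjugation by `g` replaces `U` by `U g⁻¹`; Haar measure is right-invariant by compactness, and
independence preserves the joint law with `D`. -/
theorem map_rotM_rotatedDiag {Ω : Type*} [MeasurableSpace Ω] {μ : Measure Ω}
    [IsProbabilityMeasure μ] {U : Ω → O(d)} {D : Ω → Fin d → ℝ} (hU : Measurable U)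
    (hD : Measurable D) (hHaar : (μ.map U).IsHaarMeasure) (hUD : IndepFun U D μ) (g : O(d)) :
    (μ.map fun ω => rotatedDiag (U ω) (D ω)).map (rotM g) =
      μ.map fun ω => rotatedDiag (U ω) (D ω) := by
  have hprob : IsProbabilityMeasure (μ.map U) := Measure.isProbabilityMeasure_map hU.aemeasurable
  have hprobD : IsProbabilityMeasure (μ.map D) := Measure.isProbabilityMeasure_map hD.aemeasurable
  have hright : (μ.map U).IsMulRightInvariant := isMulRightInvariant_of_probability
  have hjoint := (indepFun_iff_map_prod_eq_prod_map_map hU.aemeasurable hD.aemeasurable).mp hUD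
  have hinv : MeasurePreserving (fun p : O(d) × (Fin d → ℝ) => (p.1 * g⁻¹, p.2))
      (μ.map fun ω => (U ω, D ω)) (μ.map fun ω => (U ω, D ω)) := by
    rw [hjoint]
    exact (measurePreserving_mul_right (μ.map U) g⁻¹).prod (MeasurePreserving.id _)
  have hlaw : μ.map (fun ω => rotatedDiag (U ω) (D ω)) =
      (μ.map fun ω => (U ω, D ω)).map fun p => rotatedDiag p.1 p.2 :=
    (Measure.map_map measurable_rotatedDiag (hU.prodMk hD)).symm
  have hg : Measurable (rotM g) := Measurable.matConj measurable_const measurable_id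
  rw [hlaw, Measure.map_map hg measurable_rotatedDiag]
  conv_rhs => rw [← hinv.map_eq, Measure.map_map measurable_rotatedDiag hinv.measurable]
  congr 1
  funext p
  exact rotM_rotatedDiag g p.1 p.2

end Rotation

theorem mainTheorem6 {d K : ℕ} (hK : K ^ 2 < d) (A : AdaptiveAlgorithm d K) :
    ∃ (vt : (k : Fin K) → (H k → Vec d) → Vec d → Vec d)
      (Ut : (k : Fin K) → (H k → Vec d) → Vec d → Matrix.orthogonalGroup (Fin d) ℝ)
      (R : (H K → Vec d) → (H K → Vec d)),
      (∀ k, Measurable (Function.uncurry (vt k))) ∧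
      (∀ k, Measurable (Function.uncurry (Ut k))) ∧
      Measurable R ∧
      (∀ k x y, ‖vt k x y‖ = 1) ∧
      ∀ (Ω : Type*) [MeasurableSpace Ω] (μ : Measure Ω) [IsProbabilityMeasure μ]
        (U : Ω → Matrix.orthogonalGroup (Fin d) ℝ) (D : Ω → Fin d → ℝ)
        (Λ : Ω → Matrix (Fin d) (Fin d) ℝ) (z : Fin K → Ω → Vec d),
        Measurable U → Measurable D →
        (μ.map U).IsHaarMeasure →
        IndepFun U D μ →
        (∀ ω, Λ ω = rotatedDiag (U ω) (D ω)) →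
        (∀ k, HasLaw (z k) (stdGaussian (Vec d)) μ) →
        iIndepFun z μ →
        IndepFun Λ (fun ω k => z k ω) μ →
        (∀ᵐ ω ∂μ, A.OrthonormalOn (Λ ω)) →
        IdentDistrib
          (fun ω => rotateBack (fromKrylov Ut (Λ ω) (fun k => z k ω))
            (krylov (Λ ω) (fromKrylov vt (Λ ω) (fun k => z k ω)) K le_rfl))
          (fun ω => krylov (Λ ω) (A.query (Λ ω)) K le_rfl) μ μ ∧
        (∀ᵐ ω ∂μ, krylov (Λ ω) (fromKrylov vt (Λ ω) (fun k => z k ω)) K le_rfl =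
          R (krylov (Λ ω) (fun k => z k ω) K le_rfl)) := by
  have hd : 0 < d := by omega
  obtain ⟨e, he⟩ : ∃ e : Vec d, ‖e‖ = 1 := ⟨EuclideanSpace.single ⟨0, hd⟩ 1, by simp⟩
  refine ⟨fun k => simVec e k, simStep A e, simData K, fun k => measurable_simVec e k,
    measurable_simStep A e, measurable_simData K, fun k x y => norm_simVec he k x y, ?_⟩
  intro Ω _ μ _ U D Λ z hU hD hHaar hUD hΛ hz hzi hΛz hA
  obtain rfl : Λ = fun ω => rotatedDiag (U ω) (D ω) := funext hΛ
  have hΛm : Measurable fun ω => rotatedDiag (U ω) (D ω) :=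
    Measurable.comp (g := fun p : Matrix.orthogonalGroup (Fin d) ℝ × (Fin d → ℝ) =>
      rotatedDiag p.1 p.2) (f := fun ω => (U ω, D ω)) measurable_rotatedDiag (hU.prodMk hD)
  have hzm : AEMeasurable (fun ω k => z k ω) μ :=
    aemeasurable_pi_lambda _ fun k => (hz k).aemeasurable
  set lam := μ.map fun ω => rotatedDiag (U ω) (D ω) with hlam
  have : IsProbabilityMeasure lam := Measure.isProbabilityMeasure_map hΛm.aemeasurable
  have hinv := map_rotM_rotatedDiag hU hD hHaar hUD
  have hpi : μ.map (fun ω k => z k ω) = Measure.pi fun _ => stdGaussian (Vec d) := by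
    rw [(iIndepFun_iff_map_fun_eq_pi_map fun k => (hz k).aemeasurable).mp hzi]
    congr 1
    funext k
    exact (hz k).map_eq
  let X : Ω → Matrix (Fin d) (Fin d) ℝ × (Fin K → Vec d) := fun ω =>
    (rotatedDiag (U ω) (D ω), fun k => z k ω)
  have hXm : AEMeasurable X μ := hΛm.aemeasurable.prodMk hzm
  have hX : μ.map X = lam.prod (Measure.pi fun _ : Fin K => stdGaussian (Vec d)) := by
    rw [(indepFun_iff_map_prod_eq_prod_map_map hΛm.aemeasurable hzm).mp hΛz, hpi]
  have hnd : ∀ᵐ ω ∂μ, Nondegenerate (krylov (X ω).1 (X ω).2 K le_rfl) :=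
    ae_of_ae_map (p := fun x => Nondegenerate (krylov x.1 x.2 K le_rfl)) hXm
      (hX ▸ ae_nondegenerate hK lam)
  have hlawk (k : ℕ) (hk : k ≤ K) :
      μ.map (fun ω => rotatedMatrix A e k hk (X ω).1 (X ω).2) = lam := by
    refine Eq.trans ?_ (map_rotatedMatrix A e hinv k hk)
    rw [← hlam, ← hX,
      AEMeasurable.map_map_of_aemeasurable (measurable_rotatedMatrix A e k hk).aemeasurable hXm]
    rfl
  have hrm (k : ℕ) (hk : k ≤ K) :
      AEMeasurable (fun ω => rotatedMatrix A e k hk (X ω).1 (X ω).2) μ :=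
    Measurable.comp_aemeasurable (g := fun x : Matrix (Fin d) (Fin d) ℝ × (Fin K → Vec d) =>
      rotatedMatrix A e k hk x.1 x.2) (f := X) (measurable_rotatedMatrix A e k hk) hXm
  have hAlam : ∀ᵐ M ∂lam, A.OrthonormalOn M :=
    (ae_map_iff hΛm.aemeasurable (measurableSet_orthonormalOn A)).mpr hA
  -- Orthonormality is assumed only on `Λ`; each rotated matrix inherits it by having the same law.
  have hAk : ∀ᵐ ω ∂μ, ∀ k : Fin (K + 1),
      A.OrthonormalOn (rotatedMatrix A e k (Nat.lt_succ_iff.mp k.isLt) (X ω).1 (X ω).2) :=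
    ae_all_iff.mpr fun k => ae_of_ae_map (p := fun M => A.OrthonormalOn M) (hrm k _)
      (by rw [hlawk]; exact hAlam)
  refine ⟨?_, ?_⟩
  · have hF : Measurable fun M : Matrix (Fin d) (Fin d) ℝ => krylov M (A.query M) K le_rfl :=
      measurable_krylov measurable_id (measurable_query_family A) K le_rfl
    have hid : IdentDistrib (fun ω => rotatedMatrix A e K le_rfl (X ω).1 (X ω).2)
        (fun ω => rotatedDiag (U ω) (D ω)) μ μ := ⟨hrm K le_rfl, hΛm.aemeasurable, hlawk K le_rfl⟩
    refine IdentDistrib.trans (IdentDistrib.of_ae_eq ?_ ?_).symm (hid.comp hF)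
    · exact Measurable.comp_aemeasurable (g := fun M => krylov M (A.query M) K le_rfl)
        (f := fun ω => rotatedMatrix A e K le_rfl (X ω).1 (X ω).2) hF (hrm K le_rfl)
    · filter_upwards [hnd, hAk] with ω h1 h2
      exact (rotateBack_eq_krylov_query A he h1 fun k hk => h2 ⟨k, Nat.lt_succ_of_le hk⟩).symm
  · filter_upwards [hnd] with ω h1
    exact krylov_simVec h1 K le_rfl
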